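/- Let $\Gamma$ be an infinite group with a finite symmetric generating set $E$ and identity $e$, and let $G=\operatorname{Cay}(\Gamma,E)$ be the graph with vertex set $\Gamma$ and edges (ordered pairs) $(x,x\gamma)$, $x\in\Gamma$, $\gamma\in E$. Identify $\Gamma$ with the group of left translations in $\operatorname{Aut}(G)$, and put $\operatorname{Aut}_e(G)=\{r\in\operatorname{Aut}(G): r(e)=e\}$, a compact group in the topology of pointwise convergence. A Cayley diagram on $G$ is a labelling $d$ of the edges of $G$ by elements of $E$ such that, for every $n$ and every vertex $x$, the restriction of $d$ to the induced subgraph $B=B_n(x)$ on the $n$-step neighbourhood of $x$ satisfies: (1) for every vertex $u$ of $B$ and every $\gamma\in E$ there is at most one neighbour $v$ of $u$ in $B$ with $d(u,v)=\gamma$; (2) if $u$ has degree $|E|$ in $B$, then for every $\gamma\in E$ there is such a neighbour; (3) for every path $(x_0,\dots,x_k)$ in $B$ (vertices may repeat), $d(x_0,x_1)\cdots d(x_{k-1},x_k)=e$ if and only if $x_0=x_k$. An $\operatorname{Aut}(G)$-f.i.i.d. Cayley diagram is a Borel probability measure on the space of edge labellings of $G$ by $E$ that is concentrated on the Cayley diagrams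 and is an $\operatorname{Aut}(G)$-factor of $([0,1]^\Gamma,\lambda^\Gamma)$, where $\lambda$ is Lebesgue measure: it is the image of $\lambda^\Gamma$ under a measurable map $F$ such that, for every $f\in\operatorname{Aut}(G)$, $F(f\cdot\omega)=f\cdot F(\omega)$ for $\lambda^\Gamma$-almost every $\omega$. Here $f$ acts on vertex and edge labellings by $f\cdot\ell=\ell\circ f^{-1}$. Suppose there is a subgroup $H\le\operatorname{Aut}(G)$ such that $\Gamma\subseteq H$, the subgroup $H\cap\operatorname{Aut}_e(G)$ is closed in $\operatorname{Aut}_e(G)$ (since its index is finite, this is equivalent to its being Haar measurable), and $$1<[\operatorname{Aut}_e(G):H\cap\operatorname{Aut}_e(G)]<\infty .$$ Then $G$ does not admit an $\operatorname{Aut}(G)$-f.i.i.d. Cayley diagram. -/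

import Mathlib

open MeasureTheory Topology

namespace CayleyFIID

/-! Graphs on a vertex set `V` are relations `K : V → V → Prop` (loops are allowed), edges are ordered
pairs of neighbours, and `K ≃r K`, with composition, is the automorphism group of `K`. -/

/-- `A`-valued edge labellings of the graph `K`. -/
def EdgeLabelling {V : Type*} (K : V → V → Prop) (A : Type*) : Type _ :=
  {p : V × V // K p.1 p.2} → A

/-- The product σ-algebra, where every factor `A` is discrete. -/
instance {V : Type*} (K : V → V → Prop) (A : Type*) : MeasurableSpace (EdgeLabelling K A) :=
  @MeasurableSpace.pi _ _ (fun _ => ⊤)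

/-- The labelling `(x, y) ↦ d (g x, g y)` for a graph homomorphism `g`. -/
def EdgeLabelling.comap {V W A : Type*} {K : V → V → Prop} {L : W → W → Prop}
    (d : EdgeLabelling L A) (g : K →r L) : EdgeLabelling K A :=
  fun p => d ⟨(g p.1.1, g p.1.2), g.map_rel p.2⟩

/-- The action of automorphisms on edge labellings, `(f • d) (x, y) = d (f⁻¹ x, f⁻¹ y)`. -/
def EdgeLabelling.shift {V A : Type*} {K : V → V → Prop} (f : K ≃r K)
    (d : EdgeLabelling K A) : EdgeLabelling K A :=
  d.comap (RelIso.toRelEmbedding f.symm).toRelHom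

/-- The action of automorphisms on vertex labellings, `(f • ω) x = ω (f⁻¹ x)`. -/
def vertexShift {V A : Type*} {K : V → V → Prop} (f : K ≃r K) (ω : V → A) : V → A :=
  fun x => ω (f.symm x)

/-- The subgraph of `K` induced on `S`. -/
def induced {V : Type*} (K : V → V → Prop) (S : Set V) : S → S → Prop :=
  fun x y => K x y

/-- The inclusion of an induced subgraph. -/
def inducedHom {V : Type*} (K : V → V → Prop) (S : Set V) : induced K S →r K :=
  ⟨Subtype.val, fun h => h⟩

/-- The `n`-step neighbourhood of `x`. -/
def ball {V : Type*} (K : V → V → Prop) : ℕ → V → Set V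
  | 0, x => {x}
  | n + 1, x => {z | ∃ y ∈ ball K n x, z = y ∨ K y z}

/-- The Cayley graph of `E ⊆ Γ`: its edges are the pairs `(x, x * γ)` with `γ ∈ E`. -/
def cay {Γ : Type*} [Group Γ] (E : Finset Γ) : Γ → Γ → Prop :=
  fun x y => ∃ γ ∈ E, y = x * γ

/-- The graph `B_n(x)` in the Cayley graph. -/
abbrev ballGraph {Γ : Type*} [Group Γ] (E : Finset Γ) (n : ℕ) (x : Γ) :
    ball (cay E) n x → ball (cay E) n x → Prop :=
  induced (cay E) (ball (cay E) n x)

/-- The automorphism group of the Cayley graph. -/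
abbrev Aut {Γ : Type*} [Group Γ] (E : Finset Γ) : Type _ := cay E ≃r cay E

/-- The embedding of `Γ` into the automorphism group by left translations `δ ↦ γ * δ`. -/
def translation {Γ : Type*} [Group Γ] (E : Finset Γ) : Γ →* Aut E where
  toFun γ :=
    { toEquiv := Equiv.mulLeft γ
      map_rel_iff' := by
        intro a b
        simp [cay, mul_assoc] }
  map_one' := by ext x; simp
  map_mul' a b := by
    ext x
    exact mul_assoc a b x

/-- The stabilizer of the identity vertex in the automorphism group. -/
def rotations {Γ : Type*} [Group Γ] (E : Finset Γ) : Subgroup (Aut E) where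
  carrier := {r | r 1 = 1}
  mul_mem' := by
    intro a b ha hb
    simp only [Set.mem_ofPred_eq, RelIso.mul_apply] at *
    rw [hb, ha]
  one_mem' := by simp
  inv_mem' := by
    intro a ha
    simp only [Set.mem_ofPred_eq] at *
    conv_lhs => rw [← ha]
    exact RelIso.inv_apply_self a 1

/-- The permutation topology (pointwise convergence on the discrete vertex set). -/
@[reducible] def autTopology {Γ : Type*} [Group Γ] (E : Finset Γ) : TopologicalSpace (Aut E) :=
  TopologicalSpace.induced (fun f : Aut E => (f : Γ → Γ))
    (@Pi.topologicalSpace Γ (fun _ => Γ) (fun _ => ⊥))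

/-- The three conditions on a labelling of a graph `K` by generators: a vertex has at most one
outgoing edge with a given label, every vertex of degree `|E|` has an outgoing edge with each label,
and the labels along a path multiply to the identity if and only if the path is closed. -/
structure IsDiagramOn {Γ V : Type*} [Group Γ] (E : Finset Γ) (K : V → V → Prop)
    (d : EdgeLabelling K E) : Prop where
  unique : ∀ (x y z : V) (hy : K x y) (hz : K x z), d ⟨(x, y), hy⟩ = d ⟨(x, z), hz⟩ → y = z
  exist : ∀ x : V, {y | K x y}.encard = E.card → ∀ γ : E, ∃ (y : V) (hy : K x y), d ⟨(x, y), hy⟩ = γ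
  path : ∀ (k : ℕ) (x : Fin (k + 1) → V) (hx : ∀ i : Fin k, K (x i.castSucc) (x i.succ)),
    (List.ofFn fun i : Fin k => (d ⟨(x i.castSucc, x i.succ), hx i⟩ : Γ)).prod = 1 ↔
      x 0 = x (Fin.last k)

/-- The local constraint of radius `n`: the labellings of `B_n(1)` with the three conditions. -/
def cayleyConstraint {Γ : Type*} [Group Γ] (E : Finset Γ) (n : ℕ) :
    Set (EdgeLabelling (ballGraph E n 1) E) :=
  {d | IsDiagramOn E (ballGraph E n 1) d}

/-- The labelling `d` meets the constraint `φ` at the vertex `x`: some isomorphism from `B_n(1)` to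
`B_n(x)` carries the restriction of `d` to `B_n(x)` into `φ`. -/
def MeetsAt {Γ A : Type*} [Group Γ] {E : Finset Γ} {n : ℕ}
    (φ : Set (EdgeLabelling (ballGraph E n 1) A)) (d : EdgeLabelling (cay E) A) (x : Γ) : Prop :=
  ∃ g : ballGraph E n 1 ≃r ballGraph E n x,
    (d.comap (inducedHom (cay E) (ball (cay E) n x))).comap
      (RelIso.toRelEmbedding g).toRelHom ∈ φ

/-- Cayley diagrams on the Cayley graph of `E`. -/
def IsCayleyDiagram {Γ : Type*} [Group Γ] {E : Finset Γ} (d : EdgeLabelling (cay E) E) : Prop :=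
  ∀ (n : ℕ) (x : Γ), MeetsAt (cayleyConstraint E n) d x

/-- The law `λ^Γ` of independent uniform `[0,1]`-labels on the vertices. -/
noncomputable def iidMeasure (Γ : Type*) : Measure (Γ → unitInterval) :=
  Measure.infinitePi (fun _ : Γ => (volume : Measure unitInterval))

/-- `μ` is the image of `λ^Γ` under a measurable map that commutes with each automorphism almost
surely. (Such a `μ` is invariant under the automorphism group.) -/
def IsAutFIID {Γ A : Type*} [Group Γ] {E : Finset Γ}
    (μ : Measure (EdgeLabelling (cay E) A)) : Prop :=
  ∃ F : (Γ → unitInterval) → EdgeLabelling (cay E) A, Measurable F ∧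
    (∀ f : Aut E, ∀ᵐ ω ∂(iidMeasure Γ), F (vertexShift f ω) = (F ω).shift f) ∧
    Measure.map F (iidMeasure Γ) = μ

/-- A random Cayley diagram: a probability measure on edge labellings that is concentrated on the
Cayley diagrams. -/
def IsRandomCayleyDiagram {Γ : Type*} [Group Γ] {E : Finset Γ}
    (μ : Measure (EdgeLabelling (cay E) E)) : Prop :=
  IsProbabilityMeasure μ ∧ ∀ᵐ d ∂μ, IsCayleyDiagram d

/-- The Cayley graph of `E` admits an automorphism-f.i.i.d. Cayley diagram. -/
def AdmitsAutFIIDCayleyDiagram {Γ : Type*} [Group Γ] (E : Finset Γ) : Prop :=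
  ∃ μ : Measure (EdgeLabelling (cay E) E), IsRandomCayleyDiagram μ ∧ IsAutFIID μ

end CayleyFIID

namespace CayleyFIID

open ProbabilityTheory symmDiff

/-! ### Zero-one law for product measures. -/

section ZeroOne

variable {ι X : Type*} [MeasurableSpace X] (μ : Measure X) [IsProbabilityMeasure μ]

/-! A Cayley diagram is the standard one moved by a rotation `f`
(`IsCayleyDiagram.exists_rotation`). Automorphisms giving the same diagram differ on the right by a
translation (`inv_mul_mem_range_of_shift_eq`). Since `Γ ≤ H`, the coset `fH` depends only on the
diagram, and equivariantly so. It takes finitely many values, and measurably: `H ⊓ rotations E` is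
closed of finite index, hence open among the rotations, so finitely many values of `f` determine
`fH` (`exists_measurableSet_coset_eq`).

An f.i.i.d. diagram thus yields an equivariant random point of the finite set `Aut E ⧸ H`. Each
point is fixed by a finite-index, hence infinite, subgroup of `Γ`, so its event has probability 0 or
1 (`measure_zero_or_one_of_comp_perm`). Some coset therefore occurs almost surely. By equivariance
every automorphism fixes it, and transitivity forces `H = ⊤`, against the index being greater than
1. -/

lemma measurePreserving_comp_perm (σ : Equiv.Perm ι) :
    MeasurePreserving (fun (ω : ι → X) i => ω (σ i))
      (Measure.infinitePi fun _ => μ) (Measure.infinitePi fun _ => μ) :=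
  ⟨by fun_prop, Measure.map_infinitePi_infinitePi_of_inj (P := fun _ => μ) σ.injective⟩

/-- A cylinder over `S` is independent of its image under a permutation moving `S` off itself. -/
lemma measure_cylinder_inter_comp_perm (S : Finset ι) {B : Set (S → X)} (hB : MeasurableSet B)
    (σ : Equiv.Perm ι) (hσ : ∀ i ∈ S, σ i ∉ S) :
    (Measure.infinitePi fun _ => μ).real
        (cylinder S B ∩ (fun (ω : ι → X) i => ω (σ i)) ⁻¹' cylinder S B) =
      (Measure.infinitePi fun _ => μ).real (cylinder S B) ^ 2 := by
  classical
  set P : Measure (ι → X) := Measure.infinitePi fun _ => μ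
  have hind : IndepFun (fun ω (i : S) => ω i) (fun ω (i : S.image σ) => ω i) P := by
    refine (iIndepFun_infinitePi (P := fun _ : ι => μ) (X := fun _ x => x)
      fun _ => measurable_id).indepFun_finset S (S.image σ) ?_ fun i => measurable_pi_apply i
    rw [Finset.disjoint_left]
    rintro _ ha hb
    obtain ⟨i, hi, rfl⟩ := Finset.mem_image.1 hb
    exact hσ i hi ha
  have hind' := hind.comp (φ := id) (ψ := fun (y : S.image σ → X) (i : S) =>
    y ⟨σ i, Finset.mem_image_of_mem σ i.2⟩) measurable_id (by fun_prop)
  have h := hind'.measure_inter_preimage_eq_mul B B hB hB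
  have hT := (measurePreserving_comp_perm μ σ).measure_preimage
    (hB.cylinder (s := S)).nullMeasurableSet
  have h' : P (cylinder S B ∩ (fun (ω : ι → X) i => ω (σ i)) ⁻¹' cylinder S B) =
      P (cylinder S B) * P ((fun (ω : ι → X) i => ω (σ i)) ⁻¹' cylinder S B) := h
  rw [hT] at h'
  rw [measureReal_def, h', ENNReal.toReal_mul, sq, measureReal_def]

/-- The zero-one law for events invariant under permutations moving any finite set off itself. -/
theorem measure_zero_or_one_of_comp_perm {A : Set (ι → X)} (hA : MeasurableSet A)
    (h : ∀ S : Finset ι, ∃ σ : Equiv.Perm ι, (∀ i ∈ S, σ i ∉ S) ∧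
      (fun (ω : ι → X) i => ω (σ i)) ⁻¹' A =ᵐ[Measure.infinitePi fun _ => μ] A) :
    (Measure.infinitePi fun _ => μ) A = 0 ∨ (Measure.infinitePi fun _ => μ) A = 1 := by
  set P : Measure (ι → X) := Measure.infinitePi fun _ => μ
  -- Approximate `A` by a cylinder `C` within `ε`. Then `P(C ∩ T⁻¹C) = P(C)²` is within `2ε` of
  -- `P(A)`, while `P(C)²` is within `2ε` of `P(A)²`.
  have key : ∀ ε > 0, |P.real A - P.real A ^ 2| ≤ 4 * ε := by
    intro ε hε
    obtain ⟨B', hB', hlt⟩ := exists_measure_symmDiff_lt_of_generateFrom_isSetRing (μ := P)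
      isSetRing_measurableCylinders
      ⟨{Set.univ}, Set.countable_singleton _, Set.singleton_subset_iff.2 (univ_mem_measurableCylinders _),
        by simp⟩
      generateFrom_measurableCylinders.symm hA (ENNReal.ofReal_pos.2 hε)
    obtain ⟨S, B, hB, rfl⟩ := (mem_measurableCylinders _).1 hB'
    obtain ⟨σ, hσ, hinv⟩ := h S
    set T : (ι → X) → (ι → X) := fun ω i => ω (σ i)
    set C := cylinder (α := fun _ : ι => X) S B
    have hC : MeasurableSet C := hB.cylinder
    have hT : MeasurePreserving T P P := measurePreserving_comp_perm μ σ
    have h1 : P.real (C ∆ A) ≤ ε :=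
      ENNReal.toReal_le_of_le_ofReal hε.le hlt.le
    have h2 : P.real ((T ⁻¹' C) ∆ A) ≤ ε := by
      have e1 : P.real ((T ⁻¹' C) ∆ A) = P.real ((T ⁻¹' C) ∆ (T ⁻¹' A)) :=
        measureReal_congr (Filter.EventuallyEq.rfl.symmDiff hinv.symm)
      rw [e1, ← Set.preimage_symmDiff, measureReal_def,
        hT.measure_preimage (hC.symmDiff hA).nullMeasurableSet]
      exact h1
    have h3 : P.real ((C ∩ T ⁻¹' C) ∆ A) ≤ 2 * ε := by
      have hsub : (C ∩ T ⁻¹' C) ∆ A ⊆ (C ∆ A) ∪ ((T ⁻¹' C) ∆ A) := by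
        intro ω hω
        simp only [Set.mem_symmDiff, Set.mem_inter_iff, Set.mem_union] at hω ⊢
        tauto
      linarith [measureReal_mono (μ := P) hsub, measureReal_union_le (μ := P) (C ∆ A) ((T ⁻¹' C) ∆ A)]
    have hTC := hT.measurable hC
    have h4 := (abs_measureReal_sub_le_measureReal_symmDiff (μ := P)
      hC.nullMeasurableSet hA.nullMeasurableSet).trans h1
    have h5 := (abs_measureReal_sub_le_measureReal_symmDiff (μ := P)
      (hC.inter hTC).nullMeasurableSet hA.nullMeasurableSet).trans h3
    have h6 : P.real (C ∩ T ⁻¹' C) = P.real C ^ 2 := measure_cylinder_inter_comp_perm μ S hB σ hσ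
    rw [h6] at h5
    have hA0 : 0 ≤ P.real A := measureReal_nonneg
    have hA1 : P.real A ≤ 1 := measureReal_le_one
    have hC0 : 0 ≤ P.real C := measureReal_nonneg
    have hC1 : P.real C ≤ 1 := measureReal_le_one
    rw [abs_le] at *
    constructor <;> nlinarith
  have hz : P.real A - P.real A ^ 2 = 0 := by
    refine abs_nonpos_iff.1 (le_of_forall_pos_le_add fun ε hε => ?_)
    linarith [key (ε / 4) (by positivity)]
  have hz' : P.real A * (1 - P.real A) = 0 := by linarith [hz]
  rcases mul_eq_zero.1 hz' with h0 | h1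
  · exact Or.inl ((measureReal_eq_zero_iff).1 h0)
  · exact Or.inr ((ENNReal.toReal_eq_one_iff _).1 (by simpa [measureReal_def] using (sub_eq_zero.1 h1).symm))

end ZeroOne

/-! ### Cayley diagrams as rotations of the standard one. -/

section Diagrams

variable {Γ V : Type*} [Group Γ] {E : Finset Γ}

/-- `LabelledWalk d u v g`: some walk from `u` to `v` has labels multiplying to `g`. -/
inductive LabelledWalk {K : V → V → Prop} (d : EdgeLabelling K E) : V → V → Γ → Prop
  | nil (u : V) : LabelledWalk d u u 1
  | cons {u v w : V} {g : Γ} (h : K u v) (p : LabelledWalk d v w g) :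
      LabelledWalk d u w ((d ⟨(u, v), h⟩ : Γ) * g)

variable {K : V → V → Prop} {d : EdgeLabelling K E}

lemma LabelledWalk.exists_path {u v : V} {g : Γ} (w : LabelledWalk d u v g) :
    ∃ (k : ℕ) (x : Fin (k + 1) → V) (hx : ∀ i : Fin k, K (x i.castSucc) (x i.succ)),
      x 0 = u ∧ x (Fin.last k) = v ∧
        (List.ofFn fun i : Fin k => (d ⟨(x i.castSucc, x i.succ), hx i⟩ : Γ)).prod = g := by
  induction w with
  | nil u => exact ⟨0, fun _ => u, fun i => i.elim0, rfl, rfl, List.prod_nil⟩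
  | @cons u v w g h p ih =>
    obtain ⟨k, x, hx, rfl, rfl, rfl⟩ := ih
    refine ⟨k + 1, Fin.cons u x, Fin.cases h hx, rfl, rfl, ?_⟩
    rw [List.ofFn_succ, List.prod_cons]
    rfl

lemma LabelledWalk.edge {u v : V} (h : K u v) : LabelledWalk d u v (d ⟨(u, v), h⟩) := by
  simpa using LabelledWalk.cons (d := d) h (.nil v)

lemma LabelledWalk.trans {u v w : V} {g g' : Γ} (p : LabelledWalk d u v g)
    (q : LabelledWalk d v w g') : LabelledWalk d u w (g * g') := by
  induction p with
  | nil u => simpa using q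
  | cons h p ih => simpa [mul_assoc] using LabelledWalk.cons h (ih q)

lemma IsDiagramOn.eq_one_iff (hd : IsDiagramOn E K d) {u v : V} {g : Γ}
    (w : LabelledWalk d u v g) : g = 1 ↔ u = v := by
  obtain ⟨k, x, hx, rfl, rfl, rfl⟩ := w.exists_path
  exact hd.path k x hx

/-- The path `u, v, u` is closed, so the labels of an edge and of its reverse are mutually inverse.
-/
lemma IsDiagramOn.reverse (hd : IsDiagramOn E K d) (hK : ∀ u v, K u v → K v u) {u v : V} {g : Γ}
    (w : LabelledWalk d u v g) : LabelledWalk d v u g⁻¹ := by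
  induction w with
  | nil u => simpa using LabelledWalk.nil u
  | @cons u v w g h p ih =>
    have h1 : (d ⟨(u, v), h⟩ : Γ) * d ⟨(v, u), hK u v h⟩ = 1 :=
      (hd.eq_one_iff ((LabelledWalk.edge h).trans (.edge (hK u v h)))).2 rfl
    rw [mul_inv_rev, inv_eq_of_mul_eq_one_right h1]
    exact ih.trans (.edge _)

/-- Makes the choice of the isomorphism `B_n(1) ≃ B_n(x)` in `MeetsAt` immaterial. -/
lemma IsDiagramOn.of_iso {W : Type*} {L : W → W → Prop} {d : EdgeLabelling L E} (g : K ≃r L)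
    (hd : IsDiagramOn E K (d.comap (RelIso.toRelEmbedding g).toRelHom)) : IsDiagramOn E L d where
  unique x y z hy hz h := by
    obtain ⟨x, rfl⟩ := g.surjective x
    obtain ⟨y, rfl⟩ := g.surjective y
    obtain ⟨z, rfl⟩ := g.surjective z
    exact congrArg g (hd.unique x y z (g.map_rel_iff.1 hy) (g.map_rel_iff.1 hz) h)
  exist x hx γ := by
    obtain ⟨x, rfl⟩ := g.surjective x
    obtain ⟨y, hy, h⟩ := hd.exist x (by
      rw [← hx, ← g.injective.encard_image]
      congr 1
      ext y
      obtain ⟨y, rfl⟩ := g.surjective y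
      simp [g.map_rel_iff]) γ
    exact ⟨g y, g.map_rel_iff.2 hy, h⟩
  path k x hx := by
    obtain ⟨x, rfl⟩ : ∃ x', x = fun i => g (x' i) := ⟨fun i => g.symm (x i), by simp⟩
    exact (hd.path k x fun i => g.map_rel_iff.1 (hx i)).trans g.injective.eq_iff.symm

lemma ball_mono (K : V → V → Prop) (x : V) : Monotone fun n => ball K n x :=
  monotone_nat_of_le_succ fun _ z hz => ⟨z, hz, Or.inl rfl⟩

lemma cay_mul {x γ : Γ} (hγ : γ ∈ E) : cay E x (x * γ) := ⟨γ, hγ, rfl⟩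

lemma cay_symm (hsymm : ∀ γ ∈ E, γ⁻¹ ∈ E) (u v : Γ) (h : cay E u v) : cay E v u := by
  obtain ⟨γ, hγ, rfl⟩ := h
  exact ⟨γ⁻¹, hsymm γ hγ, by simp⟩

lemma induction_generators (hsymm : ∀ γ ∈ E, γ⁻¹ ∈ E)
    (hgen : Subgroup.closure (E : Set Γ) = ⊤) {p : Γ → Prop} (one : p 1)
    (mul : ∀ x, ∀ γ ∈ E, p x → p (x * γ)) (x : Γ) : p x := by
  have hx : x ∈ Subgroup.closure (E : Set Γ) := hgen ▸ Subgroup.mem_top x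
  induction hx using Subgroup.closure_induction_right with
  | one => exact one
  | mul_right x _ y hy ih => exact mul x y hy ih
  | mul_inv_cancel x _ y hy ih => exact mul x y⁻¹ (hsymm y hy) ih

lemma exists_mem_ball (hsymm : ∀ γ ∈ E, γ⁻¹ ∈ E)
    (hgen : Subgroup.closure (E : Set Γ) = ⊤) (x : Γ) : ∃ n, x ∈ ball (cay E) n 1 := by
  induction x using induction_generators hsymm hgen with
  | one => exact ⟨0, rfl⟩
  | mul x γ hγ ih =>
    obtain ⟨n, hn⟩ := ih
    exact ⟨n + 1, x, hn, Or.inr (cay_mul hγ)⟩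

lemma exists_forall_mem_ball (hsymm : ∀ γ ∈ E, γ⁻¹ ∈ E)
    (hgen : Subgroup.closure (E : Set Γ) = ⊤) {ι : Type*} [Finite ι] (x : ι → Γ) :
    ∃ n, ∀ i, x i ∈ ball (cay E) n 1 := by
  choose n hn using fun i => exists_mem_ball hsymm hgen (x i)
  obtain ⟨N, hN⟩ := (Set.finite_range n).bddAbove
  exact ⟨N, fun i => ball_mono _ _ (hN ⟨i, rfl⟩) (hn i)⟩

lemma IsCayleyDiagram.isDiagramOn_ball {d : EdgeLabelling (cay E) E} (hd : IsCayleyDiagram d)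
    (n : ℕ) : IsDiagramOn E (ballGraph E n 1) (d.comap (inducedHom (cay E) (ball (cay E) n 1))) := by
  obtain ⟨g, hg⟩ := hd n 1
  exact IsDiagramOn.of_iso g hg

lemma encard_neighbours (x : Γ) : {y | cay E x y}.encard = E.card := by
  rw [← Set.encard_coe_eq_coe_finsetCard, ← (mul_right_injective x).encard_image (E : Set Γ)]
  congr 1
  ext y
  exact ⟨fun ⟨γ, hγ, h⟩ => ⟨γ, hγ, h.symm⟩, fun ⟨γ, hγ, h⟩ => ⟨γ, hγ, h.symm⟩⟩

/-- Each condition involves finitely many vertices, and these lie in one ball around 1. -/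
lemma IsCayleyDiagram.isDiagramOn {d : EdgeLabelling (cay E) E} (hsymm : ∀ γ ∈ E, γ⁻¹ ∈ E)
    (hgen : Subgroup.closure (E : Set Γ) = ⊤) (hd : IsCayleyDiagram d) :
    IsDiagramOn E (cay E) d where
  unique x y z hy hz h := by
    obtain ⟨n, hn⟩ := exists_forall_mem_ball hsymm hgen ![x, y, z]
    exact congrArg Subtype.val <|
      (hd.isDiagramOn_ball n).unique ⟨x, hn 0⟩ ⟨y, hn 1⟩ ⟨z, hn 2⟩ hy hz h
  exist x _ γ := by
    obtain ⟨n, hn⟩ := exists_mem_ball hsymm hgen x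
    -- Radius `n + 1` keeps all neighbours of `x` in the ball, so `x` has full degree there.
    obtain ⟨y, hy, h⟩ := (hd.isDiagramOn_ball (n + 1)).exist ⟨x, ball_mono _ _ n.le_succ hn⟩ (by
      rw [← encard_neighbours x, ← Subtype.val_injective.encard_image]
      congr 1
      ext y
      exact ⟨fun ⟨_, h, hy⟩ => hy ▸ h, fun h => ⟨⟨y, x, hn, Or.inr h⟩, h, rfl⟩⟩) γ
    exact ⟨y, hy, h⟩
  path k x hx := by
    obtain ⟨n, hn⟩ := exists_forall_mem_ball hsymm hgen x
    exact ((hd.isDiagramOn_ball n).path k (fun i => ⟨x i, hn i⟩) hx).trans Subtype.ext_iff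

/-- The Cayley diagram labelling the edge `(x, x * γ)` with `γ`. -/
def standardDiagram (E : Finset Γ) : EdgeLabelling (cay E) E :=
  fun p => ⟨p.1.1⁻¹ * p.1.2, by obtain ⟨γ, hγ, h⟩ := p.2; simpa [h] using hγ⟩

/-- Every Cayley diagram is the image of the standard one under a rotation. -/
theorem IsCayleyDiagram.exists_rotation {d : EdgeLabelling (cay E) E}
    (hsymm : ∀ γ ∈ E, γ⁻¹ ∈ E) (hgen : Subgroup.closure (E : Set Γ) = ⊤)
    (hd : IsCayleyDiagram d) : ∃ f ∈ rotations E, (standardDiagram E).shift f = d := by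
  have hD := hd.isDiagramOn hsymm hgen
  have hrev := fun {u v g} => hD.reverse (cay_symm hsymm) (u := u) (v := v) (g := g)
  have hw : ∀ v, ∃ g, LabelledWalk d 1 v g := by
    intro v
    induction v using induction_generators hsymm hgen with
    | one => exact ⟨1, .nil 1⟩
    | mul x γ hγ ih =>
      obtain ⟨g, hg⟩ := ih
      exact ⟨_, hg.trans (.edge (cay_mul hγ))⟩
  -- `p v` is the product of labels along a walk from 1 to `v`; the path condition makes it
  -- independent of the walk and injective.
  choose p hp using hw
  have hedge : ∀ u v (h : cay E u v), p v = p u * d ⟨(u, v), h⟩ := fun u v h =>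
    (mul_inv_eq_one.1 ((hD.eq_one_iff (((hp u).trans (.edge h)).trans (hrev (hp v)))).2 rfl)).symm
  have hone : p 1 = 1 := (hD.eq_one_iff (hp 1)).2 rfl
  have hinj : Function.Injective p := fun u v h =>
    (hD.eq_one_iff ((hrev (hp u)).trans (hp v))).1 (by rw [h, inv_mul_cancel])
  have hsurj : Function.Surjective p := by
    intro g
    induction g using induction_generators hsymm hgen with
    | one => exact ⟨1, hone⟩
    | mul x γ hγ ih =>
      obtain ⟨u, rfl⟩ := ih
      obtain ⟨v, h, hv⟩ := hD.exist u (encard_neighbours u) ⟨γ, hγ⟩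
      exact ⟨v, by rw [hedge u v h, hv]⟩
  let q : Aut E :=
    { toEquiv := Equiv.ofBijective p ⟨hinj, hsurj⟩
      map_rel_iff' := by
        intro u v
        change cay E (p u) (p v) ↔ cay E u v
        constructor
        -- The edge at `u` labelled `γ` ends at some `v'` with `p v' = p u * γ = p v`; injectivity
        -- gives `v' = v`.
        · rintro ⟨γ, hγ, h⟩
          obtain ⟨v', h', hv'⟩ := hD.exist u (encard_neighbours u) ⟨γ, hγ⟩
          rwa [hinj (h.trans (by rw [hedge u v' h', hv']) : p v = p v')]
        · exact fun h => ⟨_, (d ⟨(u, v), h⟩).2, hedge u v h⟩ }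
  refine ⟨q.symm, ?_, ?_⟩
  · exact q.symm_apply_eq.2 hone.symm
  · funext ⟨⟨u, v⟩, h⟩
    apply Subtype.ext
    change (p u)⁻¹ * p v = d ⟨(u, v), h⟩
    rw [hedge u v h, inv_mul_cancel_left]

end Diagrams

/-! ### The coset of a diagram and its measurability. -/

section Cosets

variable {Γ : Type*} [Group Γ] {E : Finset Γ}

lemma measurableSet_label_eq (u v : Γ) (γ : Γ) :
    MeasurableSet {d : EdgeLabelling (cay E) E | ∃ h : cay E u v, (d ⟨(u, v), h⟩ : Γ) = γ} := by
  by_cases h : cay E u v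
  · let m : (p : {p : Γ × Γ // cay E p.1 p.2}) → MeasurableSpace E := fun _ => ⊤
    have hm : @Measurable _ _ (MeasurableSpace.pi (m := m)) ⊤
        (fun d : EdgeLabelling (cay E) E => d ⟨(u, v), h⟩) :=
      @measurable_pi_apply _ _ m ⟨(u, v), h⟩
    have hset : {d : EdgeLabelling (cay E) E | ∃ h : cay E u v, (d ⟨(u, v), h⟩ : Γ) = γ} =
        (fun d : EdgeLabelling (cay E) E => d ⟨(u, v), h⟩) ⁻¹' {a : E | (a : Γ) = γ} := by
      ext d
      exact exists_prop_of_true h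
    rw [hset]
    exact hm trivial
  · simp [h]

lemma countable_of_closure_eq_top (hsymm : ∀ γ ∈ E, γ⁻¹ ∈ E)
    (hgen : Subgroup.closure (E : Set Γ) = ⊤) : Countable Γ := by
  refine Function.Surjective.countable (f := fun w : List E => (w.map Subtype.val).prod) fun x => ?_
  induction x using induction_generators hsymm hgen with
  | one => exact ⟨[], rfl⟩
  | mul x γ hγ ih =>
    obtain ⟨w, rfl⟩ := ih
    exact ⟨w ++ [⟨γ, hγ⟩], by simp⟩

/-- The image of a vertex under a rotation is a measurable function of the rotated diagram. -/
lemma exists_measurableSet_apply_eq (hsymm : ∀ γ ∈ E, γ⁻¹ ∈ E)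
    (hgen : Subgroup.closure (E : Set Γ) = ⊤) (s v : Γ) :
    ∃ M : Set (EdgeLabelling (cay E) E), MeasurableSet M ∧
      ∀ f ∈ rotations E, (standardDiagram E).shift f ∈ M ↔ f s = v := by
  have := countable_of_closure_eq_top hsymm hgen
  induction s using induction_generators hsymm hgen generalizing v with
  | one =>
    refine ⟨{_d | (1 : Γ) = v}, .const _, fun f hf => ?_⟩
    rw [show f 1 = 1 from hf]
    rfl
  | mul s γ hγ ih =>
    choose M hM hMf using ih
    -- Here `u` stands for `f s`: in the rotated diagram, the edge from `f s` labelled `γ` ends at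
    -- `f (s * γ)`.
    refine ⟨⋃ u, M u ∩ {d | ∃ h : cay E u v, (d ⟨(u, v), h⟩ : Γ) = γ},
      .iUnion fun u => (hM u).inter (measurableSet_label_eq u v γ), fun f hf => ?_⟩
    simp only [Set.mem_iUnion, Set.mem_inter_iff, hMf _ f hf]
    constructor
    · rintro ⟨_, rfl, h, hγ'⟩
      change (f.symm (f s))⁻¹ * f.symm v = γ at hγ'
      rw [RelIso.symm_apply_apply, inv_mul_eq_iff_eq_mul] at hγ'
      rw [← hγ', RelIso.apply_symm_apply]
    · rintro rfl
      refine ⟨f s, rfl, f.map_rel_iff.2 (cay_mul hγ), ?_⟩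
      change (f.symm (f s))⁻¹ * f.symm (f (s * γ)) = γ
      simp

/-- A closed subgroup of finite index in the rotation group contains the pointwise stabilizer
of a finite set. -/
lemma exists_finset_fixing_le (H : Subgroup (Aut E)) [H.IsFiniteRelIndex (rotations E)]
    (hclosed : IsClosed[autTopology E] ((H ⊓ rotations E : Subgroup (Aut E)) : Set (Aut E))) :
    ∃ S : Finset Γ, ∀ f ∈ rotations E, (∀ s ∈ S, f s = s) → f ∈ H := by
  let _ : TopologicalSpace Γ := ⊥
  have : DiscreteTopology Γ := ⟨rfl⟩
  let _ : TopologicalSpace (Aut E) := autTopology E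
  have hcont : ∀ r : Aut E, Continuous fun f : Aut E => r * f := by
    intro r
    refine continuous_induced_rng.2 (continuous_pi fun x => ?_)
    exact (continuous_of_discreteTopology (f := r)).comp
      ((continuous_apply x).comp continuous_induced_dom)
  have : Finite (rotations E ⧸ H.subgroupOf (rotations E)) := inferInstance
  -- `W` is the finite union of the nontrivial cosets within the rotations. It is closed and misses
  -- 1, so a basic neighbourhood of 1 avoids it.
  let W : Set (Aut E) := ⋃ q ∈ {q : rotations E ⧸ H.subgroupOf (rotations E) | q ≠ ((1 : rotations E) : _)},
    (fun f => (q.out : Aut E)⁻¹ * f) ⁻¹' ((H ⊓ rotations E : Subgroup (Aut E)) : Set (Aut E))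
  have hW : IsClosed W := (Set.toFinite _).isClosed_biUnion fun q _ => hclosed.preimage (hcont _)
  have h1 : (1 : Aut E) ∈ Wᶜ := by
    simp only [W, Set.mem_compl_iff, Set.mem_iUnion, not_exists]
    intro q hq h
    apply hq
    rw [← q.out_eq']
    refine QuotientGroup.eq.2 (Subgroup.mem_subgroupOf.2 ?_)
    simpa using h.1
  obtain ⟨U, hU, hUW⟩ := isOpen_induced_iff.1 hW.isOpen_compl
  obtain ⟨S, u, hu, hS⟩ := isOpen_pi_iff.1 hU _ (hUW.symm ▸ h1 : (1 : Aut E) ∈ _)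
  refine ⟨S, fun f hf hfS => by_contra fun hfH => ?_⟩
  have hfU : f ∈ Wᶜ := by
    rw [← hUW]
    refine hS fun s hs => ?_
    change f s ∈ u s
    rw [hfS s hs]
    exact (hu s hs).2
  apply hfU
  simp only [W, Set.mem_iUnion]
  refine ⟨((⟨f, hf⟩ : rotations E) : _), fun h => hfH ?_, ?_⟩
  · simpa [Subgroup.mem_subgroupOf] using QuotientGroup.eq.1 h.symm
  · have h := QuotientGroup.eq.1 (Quotient.out_eq' ((⟨f, hf⟩ : rotations E) :
      rotations E ⧸ H.subgroupOf (rotations E)))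
    exact ⟨by simpa [Subgroup.mem_subgroupOf] using h, (rotations E).mul_mem ((rotations E).inv_mem (SetLike.coe_mem _)) hf⟩

/-- The coset of a rotation is a measurable function of the rotated diagram. -/
lemma exists_measurableSet_coset_eq (hsymm : ∀ γ ∈ E, γ⁻¹ ∈ E)
    (hgen : Subgroup.closure (E : Set Γ) = ⊤) (H : Subgroup (Aut E))
    [H.IsFiniteRelIndex (rotations E)]
    (hclosed : IsClosed[autTopology E] ((H ⊓ rotations E : Subgroup (Aut E)) : Set (Aut E)))
    (c : Aut E ⧸ H) :
    ∃ M : Set (EdgeLabelling (cay E) E), MeasurableSet M ∧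
      ∀ f ∈ rotations E, (standardDiagram E).shift f ∈ M ↔ (f : Aut E ⧸ H) = c := by
  have := countable_of_closure_eq_top hsymm hgen
  obtain ⟨S, hS⟩ := exists_finset_fixing_le H hclosed
  choose M hM hMf using exists_measurableSet_apply_eq hsymm hgen
  -- Rotations agreeing on `S` lie in one coset of `H`, so the union runs over the restrictions to
  -- `S` of rotations in `c`; it is countable because `Γ` is.
  refine ⟨⋃ v ∈ {v : S → Γ | ∃ g ∈ rotations E, (g : Aut E ⧸ H) = c ∧ ∀ s : S, g s = v s},
    ⋂ s : S, M s (v s), .biUnion (Set.to_countable _) fun v _ => .iInter fun s => hM _ _,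
    fun f hf => ?_⟩
  simp only [Set.mem_iUnion, Set.mem_iInter, hMf _ _ f hf, exists_prop]
  constructor
  · rintro ⟨v, ⟨g, hg, rfl, hgv⟩, hfv⟩
    refine (QuotientGroup.eq.2 (hS _ (mul_mem (inv_mem hg) hf) fun s hs => ?_)).symm
    change g.symm (f s) = s
    rw [RelIso.symm_apply_eq, hfv ⟨s, hs⟩, hgv ⟨s, hs⟩]
  · exact fun h => ⟨fun s => f s, ⟨f, hf, h, fun _ => rfl⟩, fun _ => rfl⟩

/-- `f⁻¹ * g` preserves the standard labels, so its value at 1 determines it along generators. -/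
lemma inv_mul_mem_range_of_shift_eq (hsymm : ∀ γ ∈ E, γ⁻¹ ∈ E)
    (hgen : Subgroup.closure (E : Set Γ) = ⊤) {f g : Aut E}
    (h : (standardDiagram E).shift f = (standardDiagram E).shift g) :
    f⁻¹ * g ∈ (translation E).range := by
  set k := f⁻¹ * g
  refine ⟨k 1, RelIso.ext fun x => ?_⟩
  change k 1 * x = k x
  induction x using induction_generators hsymm hgen with
  | one => exact mul_one _
  | mul x γ hγ ih =>
    have e := g.map_rel_iff.2 (cay_mul (x := x) hγ)
    have h1 := congrArg Subtype.val (congrFun h ⟨(g x, g (x * γ)), e⟩)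
    change (k x)⁻¹ * k (x * γ) = (g.symm (g x))⁻¹ * g.symm (g (x * γ)) at h1
    rw [RelIso.symm_apply_apply, RelIso.symm_apply_apply, inv_mul_cancel_left,
      inv_mul_eq_iff_eq_mul] at h1
    rw [h1, ← ih, mul_assoc]

/-- Every automorphism is a rotation times a translation, so every coset of `H` contains a rotation.
-/
lemma finite_quotient_of_translation_range_le (H : Subgroup (Aut E))
    [H.IsFiniteRelIndex (rotations E)] (hΓ : (translation E).range ≤ H) :
    Finite (Aut E ⧸ H) := by
  refine Finite.of_surjective (α := rotations E ⧸ H.subgroupOf (rotations E))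
    (Quotient.lift (fun f : rotations E => ((f : Aut E) : Aut E ⧸ H)) ?_) ?_
  · intro f g h
    exact QuotientGroup.eq.2 (Subgroup.mem_subgroupOf.1 (QuotientGroup.leftRel_apply.1 h))
  · intro q
    induction q using QuotientGroup.induction_on with
    | H f =>
      refine ⟨Quotient.mk'' ⟨f * translation E (f.symm 1), ?_⟩, ?_⟩
      · change f (f.symm 1 * 1) = 1
        simp
      · refine QuotientGroup.eq.2 ?_
        simpa using H.inv_mem (hΓ ⟨f.symm 1, rfl⟩)

end Cosets

/-! ### Invariance of the coset and the contradiction. -/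

section Main

variable {Γ : Type*} [Group Γ] {E : Finset Γ}

/-- A subgroup of finite index in an infinite group has an element moving a given finite set off
itself. -/
lemma exists_mem_forall_mul_notMem [Infinite Γ] (N : Subgroup Γ) [N.FiniteIndex] (S : Finset Γ) :
    ∃ γ ∈ N, ∀ s ∈ S, γ * s ∉ S := by
  classical
  have : Infinite N := by
    by_contra hN
    rw [not_infinite_iff_finite] at hN
    have : Finite (Γ ⧸ N) := inferInstance
    exact not_finite_iff_infinite.2 ‹Infinite Γ› (Finite.of_equiv _ N.groupEquivQuotientProdSubgroup.symm)
  have hinf : (N : Set Γ).Infinite := Set.infinite_coe_iff.1 this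
  obtain ⟨γ, hγ, hγS⟩ := hinf.exists_notMem_finset
    (Finset.image₂ (fun a b => a * b⁻¹) S S)
  refine ⟨γ, hγ, fun s hs h => hγS ?_⟩
  exact Finset.mem_image₂.2 ⟨_, h, _, hs, mul_inv_cancel_right γ s⟩

instance : IsProbabilityMeasure (iidMeasure Γ) := by
  unfold iidMeasure; infer_instance

lemma measurePreserving_vertexShift (f : Aut E) :
    MeasurePreserving (vertexShift (A := unitInterval) f) (iidMeasure Γ) (iidMeasure Γ) :=
  measurePreserving_comp_perm volume f.symm.toEquiv

end Main

end CayleyFIID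

open CayleyFIID in
theorem mainTheorem11 {Γ : Type*} [Group Γ] [Infinite Γ] (E : Finset Γ)
    (hsymm : ∀ γ ∈ E, γ⁻¹ ∈ E) (hgen : Subgroup.closure (E : Set Γ) = ⊤)
    (H : Subgroup (CayleyFIID.Aut E))
    (hclosed : IsClosed[CayleyFIID.autTopology E]
      ((H ⊓ CayleyFIID.rotations E : Subgroup (CayleyFIID.Aut E)) : Set (CayleyFIID.Aut E)))
    (hΓ : (CayleyFIID.translation E).range ≤ H)
    (hindex_gt : 1 < H.relIndex (CayleyFIID.rotations E))
    (hindex_fin : H.IsFiniteRelIndex (CayleyFIID.rotations E)) :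
    ¬ CayleyFIID.AdmitsAutFIIDCayleyDiagram E := by
  rintro ⟨_, ⟨hprob, hdiag⟩, F, hF, hequi, rfl⟩
  have hfin := finite_quotient_of_translation_range_le H hΓ
  have hrot : ∀ᵐ ω ∂iidMeasure Γ, ∃ f ∈ rotations E, (standardDiagram E).shift f = F ω :=
    (ae_of_ae_map hF.aemeasurable hdiag).mono fun ω hω => hω.exists_rotation hsymm hgen
  choose M hM hMf using exists_measurableSet_coset_eq hsymm hgen H hclosed
  have hshift : ∀ (g : Aut E) (c : Aut E ⧸ H), ∀ᵐ ω ∂iidMeasure Γ,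
      vertexShift g ω ∈ F ⁻¹' M (g • c) ↔ ω ∈ F ⁻¹' M c := by
    intro g c
    filter_upwards [hequi g, hrot, (measurePreserving_vertexShift g).quasiMeasurePreserving.ae hrot]
      with ω h1 ⟨f, hf, h2⟩ ⟨f', hf', h3⟩
    rw [Set.mem_preimage, Set.mem_preimage, ← h3, ← h2, hMf _ f' hf', hMf _ f hf]
    have h4 : (standardDiagram E).shift (g * f) = (standardDiagram E).shift f' := by
      rw [h3, h1, ← h2]
      rfl
    have h5 : ((g * f : Aut E) : Aut E ⧸ H) = f' :=
      QuotientGroup.eq.2 (hΓ (inv_mul_mem_range_of_shift_eq hsymm hgen h4))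
    rw [← h5, ← smul_left_cancel_iff g (x := (f : Aut E ⧸ H))]
    rfl
  have h01 : ∀ c, iidMeasure Γ (F ⁻¹' M c) = 0 ∨ iidMeasure Γ (F ⁻¹' M c) = 1 := by
    intro c
    refine measure_zero_or_one_of_comp_perm volume (hF (hM c)) fun S => ?_
    -- `Γ` acts on a finite set, so point stabilizers have finite index and contain elements moving
    -- `S` off itself.
    let _ : MulAction Γ (Aut E ⧸ H) := MulAction.compHom _ (translation E)
    have : (MulAction.stabilizer Γ c).FiniteIndex := ⟨by
      rw [MulAction.index_stabilizer]
      exact Set.ncard_ne_zero_of_mem (MulAction.mem_orbit_self c) (Set.toFinite _)⟩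
    obtain ⟨γ, hγ, hS⟩ := exists_mem_forall_mul_notMem (MulAction.stabilizer Γ c) S
    refine ⟨(translation E γ).toEquiv, hS, ?_⟩
    -- The inverse appears because `vertexShift` precomposes with the inverse automorphism.
    have hc : (translation E γ)⁻¹ • c = c := inv_mem (show _ ∈ MulAction.stabilizer (Aut E) c from hγ)
    filter_upwards [hshift (translation E γ)⁻¹ c] with ω hω
    rw [hc] at hω
    exact propext hω
  obtain ⟨c, hc⟩ : ∃ c, iidMeasure Γ (F ⁻¹' M c) = 1 := by
    by_contra! hne
    have h0 : ∀ᵐ ω ∂iidMeasure Γ, ∀ c, ω ∉ F ⁻¹' M c :=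
      ae_all_iff.2 fun c => measure_eq_zero_iff_ae_notMem.1 ((h01 c).resolve_right (hne c))
    obtain ⟨ω, h, f, hf, hω⟩ := (h0.and hrot).exists
    exact h f (by rw [Set.mem_preimage, ← hω, hMf _ f hf])
  have hone : ∀ᵐ ω ∂iidMeasure Γ, ω ∈ F ⁻¹' M c :=
    (mem_ae_iff_prob_eq_one (hF (hM c))).2 hc
  have hfix : ∀ g : Aut E, g • c = c := by
    intro g
    obtain ⟨ω, h1, h2, h3, f, hf, h4⟩ := (hone.and <| (hshift g c).and <|
      ((measurePreserving_vertexShift g).quasiMeasurePreserving.ae (hone.and hrot))).exists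
    have h5 := h2.2 h1
    rw [Set.mem_preimage, ← h4, hMf _ f hf] at h3 h5
    exact h5.symm.trans h3
  have htop : H = ⊤ := by
    refine eq_top_iff.2 fun g _ => ?_
    obtain ⟨a, rfl⟩ := QuotientGroup.mk_surjective c
    -- The stabilizer of `aH` is `aHa⁻¹`; this conjugate is chosen so that the membership reduces to
    -- `g ∈ H`.
    have := QuotientGroup.eq.1 (hfix (a * g⁻¹ * a⁻¹))
    simpa using this
  rw [htop, Subgroup.relIndex_top_left] at hindex_gt
  exact lt_irrefl _ hindex_gt
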